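/- Let $d\ge 0$ be an integer. For $x\in\mathbb R^d$ write $\hat x=(x_1,\dots,x_d,1)\in\mathbb R^{d+1}$ and $\mathcal V(x)=\hat x\hat x^{\mathsf T}$, a symmetric $(d+1)\times(d+1)$ matrix. A framework $(G,r)$ in $\mathbb R^d$ is a finite simple graph $G$ with $n$ vertices together with a map $r$ from its vertices to $\mathbb R^d$. It is *super stable* if the points $r(v)$ affinely span $\mathbb R^d$ and the following two conditions hold: 1. there is a real symmetric positive semidefinite $n\times n$ matrix $\Omega$, indexed by the vertices, of rank $n-d-1$, such that $\Omega_{vw}=0$ whenever $v\ne w$ are not adjacent, $\Omega\mathbf 1=0$ for the all-ones vector $\mathbf 1$, and $\sum_{w}\Omega_{vw}\,r(w)=0$ for every vertex $v$; 2. there is no nonzero symmetric $d\times d$ matrix $Q$ with $(r(w)-r(v))^{\mathsf T}Q\,(r(w)-r(v))=0$ for all edges $\{v,w\}$ of $G$ (the edge directions are not on a conic at infinity). **Proposition.** For every $d$ there are configurations $p=(p_1,\dots,p_{d+1})$ and $q=(q_1,\dots,q_{d+1})$ in $\mathbb R^d$ that alternate along the moment curve $\gamma(t)=(t^d,t^{d-1},\dots,t)$,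 that is, $p_i=\gamma(s_i)$ and $q_i=\gamma(t_i)$ for some real numbers $s_1<t_1<s_2<t_2<\dots<s_{d+1}<t_{d+1}$, such that: (a) $p$ and $q$ each affinely span $\mathbb R^d$; (b) the matrices $\mathcal V(p_1),\dots,\mathcal V(p_{d+1}),\mathcal V(q_1),\dots,\mathcal V(q_{d+1})$ have a linear span of dimension $2d+1$; (c) the framework $(K_{d+1,d+1},p,q)$, in which the vertices of one part of the complete bipartite graph are placed at $p_1,\dots,p_{d+1}$ and those of the other part at $q_1,\dots,q_{d+1}$, is super stable. -/

import Mathlib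

noncomputable section

namespace Rigidity

/-- Points of `d`-dimensional Euclidean space. -/
abbrev Pt (d : ℕ) : Type := EuclideanSpace ℝ (Fin d)

/-- The affine coordinates `x̂ = (x₁, …, x_d, 1)` of a point `x`. -/
def homog {d : ℕ} (x : Pt d) : Fin (d + 1) → ℝ :=
  Fin.snoc (α := fun _ => ℝ) (fun i => x i) 1

/-- The configuration matrix: its row at the vertex `i` consists of the affine coordinates
of `p i`. -/
def configMatrix {V : Type*} {d : ℕ} (p : V → Pt d) : Matrix V (Fin (d + 1)) ℝ :=
  Matrix.of fun i => homog (p i)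

/-- The configuration `p` has `d`-dimensional affine span in `d`-dimensional space. -/
def HasFullAffineSpan {V : Type*} {d : ℕ} (p : V → Pt d) : Prop :=
  affineSpan ℝ (Set.range p) = ⊤

/-- The Veronese map on points, `x ↦ x̂ x̂ᵀ`. -/
def veronese {d : ℕ} (x : Pt d) : Matrix (Fin (d + 1)) (Fin (d + 1)) ℝ :=
  Matrix.vecMulVec (homog x) (homog x)

/-- `Ω` is a stress matrix of the graph `G`: it is symmetric, its off-diagonal entries vanish at
non-edges of `G`, and the vector of all ones is in its kernel. -/
structure IsStressMatrix {V : Type*} [Fintype V] (G : SimpleGraph V) (Ω : Matrix V V ℝ) :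
    Prop where
  isSymm : Ω.IsSymm
  support : ∀ i j, i ≠ j → ¬ G.Adj i j → Ω i j = 0
  mulVec_one : Ω.mulVec (fun _ => 1) = 0

/-- `Ω` is an equilibrium stress matrix of the framework `(G, p)`. -/
def IsEquilibriumStressMatrix {V : Type*} [Fintype V] {d : ℕ} (G : SimpleGraph V)
    (p : V → Pt d) (Ω : Matrix V V ℝ) : Prop :=
  IsStressMatrix G Ω ∧ Ω * configMatrix p = 0

/-- The edge directions of `(G, p)` lie on a conic at infinity: some nonzero quadratic form,
given by a symmetric `d × d` matrix `Q`, vanishes at every edge direction `p j - p i`. -/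
def EdgeDirectionsOnConic {V : Type*} {d : ℕ} (G : SimpleGraph V) (p : V → Pt d) : Prop :=
  ∃ Q : Matrix (Fin d) (Fin d) ℝ, Q.IsSymm ∧ Q ≠ 0 ∧
    ∀ i j, G.Adj i j →
      (fun a => p j a - p i a) ⬝ᵥ Q.mulVec (fun a => p j a - p i a) = 0

/-- The framework `(G, p)` with `n` vertices in dimension `d` is super stable: it has
`d`-dimensional affine span, it has a positive semidefinite equilibrium stress matrix of
rank `n - d - 1`, and its edge directions are not on a conic at infinity. -/
def SuperStable {V : Type*} [Fintype V] {d : ℕ} (G : SimpleGraph V) (p : V → Pt d) : Prop :=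
  HasFullAffineSpan p ∧
  (∃ Ω : Matrix V V ℝ, IsEquilibriumStressMatrix G p Ω ∧ Ω.PosSemidef ∧
    Ω.rank + (d + 1) = Fintype.card V) ∧
  ¬ EdgeDirectionsOnConic G p

/-- The moment curve `t ↦ (t ^ d, t ^ (d - 1), …, t)`. -/
def momentCurve (d : ℕ) (t : ℝ) : Pt d :=
  WithLp.toLp 2 fun i : Fin d => t ^ (d - (i : ℕ))

/-- `p` and `q` alternate along the curve `f`: there are parameters
`s₁ < t₁ < s₂ < t₂ < ⋯` with `p i = f (s i)` and `q i = f (t i)`. -/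
def AlternatingOn {m d : ℕ} (f : ℝ → Pt d) (p q : Fin m → Pt d) : Prop :=
  ∃ s t : Fin m → ℝ, (∀ i, s i < t i) ∧ (∀ i j, i < j → t i < s j) ∧
    (∀ i, p i = f (s i)) ∧ (∀ i, q i = f (t i))

end Rigidity

end

open Matrix

namespace Rigidity

/-! Put `p` at the even parameters 0, 2, …, 2d and `q` at the odd ones 1, 3, …, 2d+1. The (2d+1)-st
finite difference kills polynomials of degree at most 2d, so binomial weights give both sets equal
moments up to order 2d. Entries of the Veronese matrices on the curve are such powers, so Pᵀ diag(l)
P = Qᵀ diag(m) Q for the configuration matrices P, Q, with l, m > 0.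

This balance gives the stress: for C = [I, -PQ⁻¹], the matrix Cᵀ diag(l) C is positive semidefinite
of rank d+1, kills the configuration, and has diagonal blocks diag(l) and diag(m), as the bipartite
graph requires. Vandermonde determinants supply the affine bases and the dimension count. -/

@[simp] lemma homog_castSucc {d : ℕ} (x : Pt d) (i : Fin d) : homog x i.castSucc = x i := by
  simp [homog]

@[simp] lemma homog_last {d : ℕ} (x : Pt d) : homog x (Fin.last d) = 1 := by
  simp [homog]

lemma homog_momentCurve (d : ℕ) (t : ℝ) (i : Fin (d + 1)) :
    homog (momentCurve d t) i = t ^ (d - (i : ℕ)) := by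
  induction i using Fin.lastCases with
  | last => simp
  | cast i => simp [momentCurve]

lemma configMatrix_momentCurve {d : ℕ} (s : Fin (d + 1) → ℝ) :
    configMatrix (fun i => momentCurve d (s i)) =
      (vandermonde s).submatrix id Fin.revPerm := by
  ext i j
  simp only [configMatrix, of_apply, homog_momentCurve, submatrix_apply, id, vandermonde_apply,
    Fin.revPerm_apply, Fin.val_rev]
  congr 1
  omega

lemma det_configMatrix_momentCurve_ne_zero {d : ℕ} {s : Fin (d + 1) → ℝ}
    (hs : Function.Injective s) :
    (configMatrix fun i => momentCurve d (s i)).det ≠ 0 := by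
  rw [configMatrix_momentCurve, det_permute']
  exact mul_ne_zero (by simp) (det_vandermonde_ne_zero_iff.2 hs)

/-- An affine dependence is a left kernel vector of the configuration matrix: the last column
records that the weights sum to zero. -/
lemma hasFullAffineSpan_of_det_ne_zero {d : ℕ} {p : Fin (d + 1) → Pt d}
    (hp : (configMatrix p).det ≠ 0) : HasFullAffineSpan p := by
  have hi : AffineIndependent ℝ p := by
    rw [affineIndependent_iff_of_fintype]
    intro w hw hwp i
    rw [Finset.univ.weightedVSub_eq_linear_combination hw] at hwp
    refine congrFun (eq_zero_of_vecMul_eq_zero hp (v := w) ?_) i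
    ext j
    induction j using Fin.lastCases with
    | last => simpa [vecMul, dotProduct, configMatrix] using hw
    | cast j =>
      have := congrArg (fun x : Pt d => x j) hwp
      simpa [vecMul, dotProduct, configMatrix] using this
  exact hi.affineSpan_eq_top_iff_card_eq_finrank_add_one.2 (by simp)

lemma HasFullAffineSpan.sumElim_left {V W : Type*} {d : ℕ} {p : V → Pt d}
    (hp : HasFullAffineSpan p) (q : W → Pt d) : HasFullAffineSpan (Sum.elim p q) := by
  refine top_le_iff.1 (hp.symm.le.trans (affineSpan_mono ℝ ?_))
  rintro _ ⟨i, rfl⟩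
  exact ⟨Sum.inl i, rfl⟩

/-! ### Conics at infinity -/

/-- The extension of a quadratic form on `ℝ ^ d` to affine coordinates. -/
def extendForm {d : ℕ} (Q : Matrix (Fin d) (Fin d) ℝ) : Matrix (Fin (d + 1)) (Fin (d + 1)) ℝ :=
  of (Fin.snoc (α := fun _ => Fin (d + 1) → ℝ)
    (fun i => Fin.snoc (α := fun _ => ℝ) (Q i) 0) 0)

lemma homog_dotProduct_extendForm {d : ℕ} (Q : Matrix (Fin d) (Fin d) ℝ) (x y : Pt d) :
    homog x ⬝ᵥ extendForm Q *ᵥ homog y = (x : Fin d → ℝ) ⬝ᵥ Q *ᵥ (y : Fin d → ℝ) := by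
  simp [dotProduct, mulVec, extendForm, Fin.sum_univ_castSucc]

/-- Vanishing on all `q j - p i` forces 2 pᵢᵀQqⱼ = aᵢ + cⱼ. As both configuration matrices are
invertible, twice the extended form equals α eᵀ + e βᵀ. -/
lemma not_edgeDirectionsOnConic_completeBipartiteGraph {d : ℕ} {p q : Fin (d + 1) → Pt d}
    (hp : (configMatrix p).det ≠ 0) (hq : (configMatrix q).det ≠ 0) :
    ¬ EdgeDirectionsOnConic (completeBipartiteGraph (Fin (d + 1)) (Fin (d + 1)))
      (Sum.elim p q) := by
  rintro ⟨Q, hQ, hQ0, h⟩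
  have hp' : IsUnit (configMatrix p).det := isUnit_iff_ne_zero.2 hp
  have hq' : IsUnit (configMatrix q).det := isUnit_iff_ne_zero.2 hq
  let a : Fin (d + 1) → ℝ := fun i => (p i : Fin d → ℝ) ⬝ᵥ Q *ᵥ (p i : Fin d → ℝ)
  let c : Fin (d + 1) → ℝ := fun i => (q i : Fin d → ℝ) ⬝ᵥ Q *ᵥ (q i : Fin d → ℝ)
  let e : Fin (d + 1) → ℝ := Pi.single (Fin.last d) 1
  let α := (configMatrix p)⁻¹ *ᵥ a
  let β := (configMatrix q)⁻¹ *ᵥ c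
  have hα : configMatrix p *ᵥ α = a := by simp [α, mul_nonsing_inv _ hp']
  have hβ : configMatrix q *ᵥ β = c := by simp [β, mul_nonsing_inv _ hq']
  have hpe : configMatrix p *ᵥ e = 1 := by ext i; simp [e, configMatrix]
  have hqe : configMatrix q *ᵥ e = 1 := by ext i; simp [e, configMatrix]
  let M := (2 : ℝ) • extendForm Q - vecMulVec α e - vecMulVec e β
  have key : configMatrix p * M * (configMatrix q)ᵀ = 0 := by
    simp only [M, Matrix.mul_sub, Matrix.sub_mul, mul_vecMulVec, vecMulVec_mul, vecMul_transpose,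
      hα, hβ, hpe, hqe]
    ext i j
    have hij := h (Sum.inl i) (Sum.inr j) (by simp)
    have hsub : (fun a => Sum.elim p q (Sum.inr j) a - Sum.elim p q (Sum.inl i) a) =
        (q j : Fin d → ℝ) - (p i : Fin d → ℝ) := rfl
    have hsymm : (q j : Fin d → ℝ) ⬝ᵥ Q *ᵥ (p i : Fin d → ℝ) =
        (p i : Fin d → ℝ) ⬝ᵥ Q *ᵥ (q j : Fin d → ℝ) := by
      rw [dotProduct_mulVec, dotProduct_comm, ← mulVec_transpose, hQ.eq]
    rw [hsub, mulVec_sub, dotProduct_sub, sub_dotProduct, sub_dotProduct, hsymm] at hij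
    have hX : (configMatrix p * extendForm Q * (configMatrix q)ᵀ) i j =
        (p i : Fin d → ℝ) ⬝ᵥ Q *ᵥ (q j : Fin d → ℝ) := by
      rw [← homog_dotProduct_extendForm, Matrix.mul_assoc]
      rfl
    simp only [Matrix.mul_smul, Matrix.smul_mul, Matrix.sub_apply, Matrix.smul_apply, hX, vecMulVec_apply,
      Pi.one_apply, smul_eq_mul, Matrix.zero_apply, a, c]
    linarith
  have hM : M = 0 := by
    have hqT : IsUnit (configMatrix q)ᵀ.det := by rwa [det_transpose]
    have h1 : configMatrix p * M = 0 := by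
      simpa [mul_nonsing_inv_cancel_right _ _ hqT] using congrArg (· * (configMatrix q)ᵀ⁻¹) key
    simpa [nonsing_inv_mul_cancel_left _ _ hp'] using congrArg ((configMatrix p)⁻¹ * ·) h1
  -- Since e is the last basis vector, α eᵀ + e βᵀ vanishes on the upper left d × d block, where the
  -- extended form is Q.
  apply hQ0
  ext i j
  simpa [M, extendForm, vecMulVec_apply, e] using congrFun₂ hM i.castSucc j.castSucc

/-! ### The stress matrix -/

/-- Two affine bases carrying positive weights with equal second moments form a super stable
framework on the complete bipartite graph. -/
theorem superStable_completeBipartiteGraph {d : ℕ} {p q : Fin (d + 1) → Pt d}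
    (hp : (configMatrix p).det ≠ 0) (hq : (configMatrix q).det ≠ 0)
    {l m : Fin (d + 1) → ℝ} (hl : ∀ i, 0 < l i)
    (h : (configMatrix p)ᵀ * diagonal l * configMatrix p =
      (configMatrix q)ᵀ * diagonal m * configMatrix q) :
    SuperStable (completeBipartiteGraph (Fin (d + 1)) (Fin (d + 1))) (Sum.elim p q) := by
  refine ⟨(hasFullAffineSpan_of_det_ne_zero hp).sumElim_left q, ?_,
    not_edgeDirectionsOnConic_completeBipartiteGraph hp hq⟩
  have hq' : IsUnit (configMatrix q).det := isUnit_iff_ne_zero.2 hq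
  have hqT : IsUnit (configMatrix q)ᵀ.det := by rwa [det_transpose]
  let B := -(configMatrix p * (configMatrix q)⁻¹)
  let C : Matrix (Fin (d + 1)) (Fin (d + 1) ⊕ Fin (d + 1)) ℝ := fromCols 1 B
  let Ω := Cᵀ * diagonal l * C
  have hpq : configMatrix (Sum.elim p q) = fromRows (configMatrix p) (configMatrix q) := by
    ext (i | i) j <;> simp [configMatrix]
  -- The equal second moments are exactly what makes the second diagonal block diagonal.
  have hB : Bᵀ * diagonal l * B = diagonal m := by
    have : Bᵀ * diagonal l * B = (configMatrix q)ᵀ⁻¹ *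
        ((configMatrix p)ᵀ * diagonal l * configMatrix p) * (configMatrix q)⁻¹ := by
      simp [B, transpose_mul, transpose_nonsing_inv, Matrix.mul_assoc]
    rw [this, h, Matrix.mul_assoc, mul_nonsing_inv_cancel_right _ _ hq',
      nonsing_inv_mul_cancel_left _ _ hqT]
  have hC : C * configMatrix (Sum.elim p q) = 0 := by
    rw [hpq, fromCols_mul_fromRows]
    simp [B, Matrix.mul_assoc, nonsing_inv_mul _ hq']
  have hΩ0 : Ω * configMatrix (Sum.elim p q) = 0 := by
    simp only [Ω, Matrix.mul_assoc, hC, Matrix.mul_zero]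
  have hΩ : Ω = fromBlocks (diagonal l) (diagonal l * B) (Bᵀ * diagonal l) (diagonal m) := by
    rw [← hB]
    simp [Ω, C, transpose_fromCols, fromRows_mul]
  have hpsd : Ω.PosSemidef := by
    have := (PosSemidef.diagonal (fun i => (hl i).le) :
      (diagonal l).PosSemidef).conjTranspose_mul_mul_same C
    simpa [conjTranspose_eq_transpose_of_trivial] using this
  refine ⟨Ω, ⟨⟨?_, ?_, ?_⟩, hΩ0⟩, hpsd, ?_⟩
  · simp [IsSymm, Ω, Matrix.mul_assoc]
  · rw [hΩ]
    rintro (i | i) (j | j) hij hadj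
    · exact diagonal_apply_ne _ (by simpa using hij)
    · simp at hadj
    · simp at hadj
    · exact diagonal_apply_ne _ (by simpa using hij)
  · ext v
    have := congrFun₂ hΩ0 v (Fin.last d)
    simpa [mul_apply, mulVec, dotProduct, configMatrix] using this
  -- Above, `C` has d+1 rows; below, the block diag(l) is invertible.
  · have hle : Ω.rank ≤ d + 1 := by
      simpa using (rank_mul_le_right (Cᵀ * diagonal l) C).trans C.rank_le_card_height
    have hge : d + 1 ≤ Ω.rank := by
      have h1 := rank_submatrix_le Ω Sum.inl Sum.inl
      have h2 : Ω.submatrix Sum.inl Sum.inl = diagonal l := by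
        rw [hΩ]
        rfl
      have h3 : (diagonal l).rank = d + 1 := by
        have hdet : IsUnit (diagonal l).det := by
          rw [det_diagonal, isUnit_iff_ne_zero]
          exact Finset.prod_ne_zero_iff.2 fun i _ => (hl i).ne'
        rw [rank_of_isUnit _ ((isUnit_iff_isUnit_det _).2 hdet), Fintype.card_fin]
      rwa [h2, h3] at h1
    simp only [Fintype.card_sum, Fintype.card_fin]
    omega

/-! ### Dimension of the Veronese span -/

/-- The Veronese matrices of the moment curve, as Hankel matrices of the powers up to `2 d`. -/
def hankel (d : ℕ) : (Fin (2 * d + 1) → ℝ) →ₗ[ℝ] Matrix (Fin (d + 1)) (Fin (d + 1)) ℝ where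
  toFun c := of fun i j => c ⟨(d - (i : ℕ)) + (d - (j : ℕ)), by omega⟩
  map_add' _ _ := rfl
  map_smul' _ _ := rfl

lemma hankel_apply {d : ℕ} (c : Fin (2 * d + 1) → ℝ) (i j : Fin (d + 1)) :
    hankel d c i j = c ⟨(d - (i : ℕ)) + (d - (j : ℕ)), by omega⟩ := rfl

lemma hankel_injective (d : ℕ) : Function.Injective (hankel d) := by
  intro c c' h
  ext k
  -- Each k ≤ 2d splits into halves k/2 and k - k/2, both at most d, so c k occurs as an entry.
  have hk := congrFun₂ h (⟨d - (k : ℕ) / 2, by omega⟩ : Fin (d + 1))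
    ⟨d - ((k : ℕ) - (k : ℕ) / 2), by omega⟩
  have hidx : (⟨(d - (d - (k : ℕ) / 2)) + (d - (d - ((k : ℕ) - (k : ℕ) / 2))), by omega⟩ :
      Fin (2 * d + 1)) = k := Fin.ext (by simp only; omega)
  simpa only [hankel_apply, hidx] using hk

lemma veronese_momentCurve (d : ℕ) (t : ℝ) :
    veronese (momentCurve d t) = hankel d fun k => t ^ (k : ℕ) := by
  ext i j
  simp [veronese, vecMulVec_apply, homog_momentCurve, hankel_apply, pow_add]

lemma finrank_span_veronese_momentCurve {ι : Type*} {d : ℕ} (x : ι → ℝ)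
    {u : Fin (2 * d + 1) → ℝ} (hu : Function.Injective u) (hux : ∀ k, u k ∈ Set.range x) :
    Module.finrank ℝ (Submodule.span ℝ (Set.range fun v => veronese (momentCurve d (x v)))) =
      2 * d + 1 := by
  have htop : Submodule.span ℝ (Set.range fun v => fun k : Fin (2 * d + 1) => x v ^ (k : ℕ)) =
      ⊤ := by
    have hli : LinearIndependent ℝ (vandermonde u).row :=
      linearIndependent_rows_of_det_ne_zero (det_vandermonde_ne_zero_iff.2 hu)
    rw [← top_le_iff, ← hli.span_eq_top_of_card_eq_finrank' (by simp)]
    refine Submodule.span_mono ?_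
    rintro _ ⟨k, rfl⟩
    obtain ⟨v, hv⟩ := hux k
    exact ⟨v, by ext; simp [hv, vandermonde_apply]⟩
  have himage : (Set.range fun v => veronese (momentCurve d (x v))) =
      hankel d '' Set.range fun v => fun k : Fin (2 * d + 1) => x v ^ (k : ℕ) := by
    rw [← Set.range_comp]
    exact congrArg Set.range (funext fun v => veronese_momentCurve d (x v))
  rw [himage, ← Submodule.map_span, htop, Submodule.map_top,
    LinearMap.finrank_range_of_inj (hankel_injective d), Module.finrank_fin_fun]

/-! ### Equality of moments -/

lemma sum_range_two_mul {M : Type*} [AddCommMonoid M] (f : ℕ → M) (n : ℕ) :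
    ∑ k ∈ Finset.range (2 * n), f k =
      ∑ i ∈ Finset.range n, f (2 * i) + ∑ i ∈ Finset.range n, f (2 * i + 1) := by
  induction n with
  | zero => simp
  | succ n ih =>
    rw [show 2 * (n + 1) = 2 * n + 1 + 1 by ring, Finset.sum_range_succ, Finset.sum_range_succ, ih,
      Finset.sum_range_succ, Finset.sum_range_succ]
    abel

/-- The binomial weights on the even and on the odd numbers have the same low moments. -/
lemma sum_choose_even_pow_eq_sum_choose_odd_pow {d k : ℕ} (hk : k < 2 * d + 1) :
    ∑ i : Fin (d + 1), ((2 * d + 1).choose (2 * i) : ℝ) * (2 * (i : ℕ) : ℝ) ^ k =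
      ∑ i : Fin (d + 1), ((2 * d + 1).choose (2 * i + 1) : ℝ) * (2 * (i : ℕ) + 1 : ℝ) ^ k := by
  -- The difference of order 2d+1 of x ↦ x ^ k at 0; as the order is odd, even nodes get sign -1 and
  -- odd nodes +1.
  have h := congrFun (fwdDiff_iter_pow_eq_zero_of_lt (R := ℝ) hk) 0
  rw [fwdDiff_iter_eq_sum_shift, show 2 * d + 1 + 1 = 2 * (d + 1) by ring,
    sum_range_two_mul, Finset.sum_range, Finset.sum_range] at h
  have heven (i : Fin (d + 1)) : (-1 : ℤ) ^ (2 * d + 1 - 2 * (i : ℕ)) = -1 :=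
    Odd.neg_one_pow ⟨d - i, by omega⟩
  have hodd (i : Fin (d + 1)) : (-1 : ℤ) ^ (2 * d + 1 - (2 * (i : ℕ) + 1)) = 1 :=
    Even.neg_one_pow ⟨d - i, by omega⟩
  simp only [heven, hodd, zsmul_eq_mul, nsmul_eq_mul, zero_add, mul_one, Pi.zero_apply] at h
  push_cast at h
  simp only [neg_mul, one_mul, Finset.sum_neg_distrib] at h
  linarith

end Rigidity

theorem proposition3p1 (d : ℕ) :
    ∃ p q : Fin (d + 1) → Rigidity.Pt d,
      Rigidity.AlternatingOn (Rigidity.momentCurve d) p q ∧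
      (Rigidity.HasFullAffineSpan p ∧ Rigidity.HasFullAffineSpan q) ∧
      Module.finrank ℝ
        (Submodule.span ℝ (Set.range fun v => Rigidity.veronese (Sum.elim p q v))) = 2 * d + 1 ∧
      Rigidity.SuperStable (completeBipartiteGraph (Fin (d + 1)) (Fin (d + 1))) (Sum.elim p q) := by
  let s : Fin (d + 1) → ℝ := fun i => 2 * (i : ℕ)
  let t : Fin (d + 1) → ℝ := fun i => 2 * (i : ℕ) + 1
  have hs : Function.Injective s := fun i j h => by simpa [s, Fin.ext_iff] using h
  have ht : Function.Injective t := fun i j h => by simpa [t, Fin.ext_iff] using h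
  have hp := Rigidity.det_configMatrix_momentCurve_ne_zero hs
  have hq := Rigidity.det_configMatrix_momentCurve_ne_zero ht
  refine ⟨fun i => Rigidity.momentCurve d (s i), fun i => Rigidity.momentCurve d (t i),
    ⟨s, t, fun i => by simp [s, t], fun i j hij => ?_, fun _ => rfl, fun _ => rfl⟩,
    ⟨Rigidity.hasFullAffineSpan_of_det_ne_zero hp, Rigidity.hasFullAffineSpan_of_det_ne_zero hq⟩,
    ?_, ?_⟩
  · have hij' : 2 * (i : ℕ) + 1 < 2 * (j : ℕ) := by omega
    simp only [s, t]
    exact_mod_cast hij'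
  · have hx : (fun v => Rigidity.veronese (Sum.elim (fun i => Rigidity.momentCurve d (s i))
        (fun i => Rigidity.momentCurve d (t i)) v)) =
        fun v => Rigidity.veronese (Rigidity.momentCurve d (Sum.elim s t v)) := by
      ext (v | v) <;> rfl
    rw [hx]
    -- Of the 2d+2 parameters 0, …, 2d+1, the first 2d+1 already suffice; parity decides the side of
    -- each.
    refine Rigidity.finrank_span_veronese_momentCurve _ (u := fun k => ((k : ℕ) : ℝ))
      (fun i j h => by simpa [Fin.ext_iff] using h) fun k => ?_
    obtain h | h := Nat.mod_two_eq_zero_or_one k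
    · refine ⟨Sum.inl ⟨(k : ℕ) / 2, by omega⟩, ?_⟩
      have hk : 2 * ((k : ℕ) / 2) = k := by omega
      simp only [Sum.elim_inl, s]
      exact_mod_cast hk
    · refine ⟨Sum.inr ⟨(k : ℕ) / 2, by omega⟩, ?_⟩
      have hk : 2 * ((k : ℕ) / 2) + 1 = k := by omega
      simp only [Sum.elim_inr, t]
      exact_mod_cast hk
  · refine Rigidity.superStable_completeBipartiteGraph hp hq
      (l := fun i => ((2 * d + 1).choose (2 * i) : ℝ))
      (m := fun i => ((2 * d + 1).choose (2 * i + 1) : ℝ))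
      (fun i => Nat.cast_pos.2 (Nat.choose_pos (by omega))) ?_
    ext i j
    have h := Rigidity.sum_choose_even_pow_eq_sum_choose_odd_pow
      (show (d - (i : ℕ)) + (d - (j : ℕ)) < 2 * d + 1 by omega)
    simp only [pow_add] at h
    rw [Matrix.mul_apply, Matrix.mul_apply]
    simp only [Matrix.mul_diagonal, Matrix.transpose_apply,
      Rigidity.configMatrix, Matrix.of_apply, Rigidity.homog_momentCurve, s, t]
    convert h using 2 <;> ring
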